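/- Work over $\mathbb{C}$ and let $X=\mathbb{P}^1\times\mathbb{P}^1$, with projections $p,q$ to $\mathbb{P}^1$. For $n,m\in\mathbb{Z}$ put $\mathcal{O}(n,m)=p^*\mathcal{O}(n)\otimes q^*\mathcal{O}(m)$ and $F(n,m)=F\otimes\mathcal{O}(n,m)$ for a sheaf of $\mathcal{O}_X$-modules $F$; a morphism $\varphi\colon F\to G$ induces $\varphi(n,m)=\varphi\otimes\mathrm{id}\colon F(n,m)\to G(n,m)$. A monad on $X$ is a complex of vector bundles (of finite rank) $\mathcal{M}^\bullet\colon 0\to A\xrightarrow{f}B\xrightarrow{g}C\to 0$ on $X$ in which $f$ is an injective bundle map (injective on every fibre) and $g$ is surjective; its cohomology bundle is $E=\ker(g)/\operatorname{im}(f)$. Write $H^i(\mathcal{M}^\bullet(n,m))=H^i(A(n,m))\oplus H^i(B(n,m))\oplus H^i(C(n,m))$. The monad has natural cohomology if for every $(n,m)\in\mathbb{Z}^2$ there is at most one $i\ge 0$ with $H^i(\mathcal{M}^\bullet(n,m))\neq 0$. **Proposition.** Let $\mathcal{M}^\bullet$ be a monad on $\mathbb{P}^1\times\mathbb{P}^1$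 with natural cohomology, let $E$ be its cohomology bundle, and let $n,m\in\mathbb{Z}$. Then there are isomorphisms of $\mathbb{C}$-vector spaces as follows. 1. If $H^0(\mathcal{M}^\bullet(n,m))\neq 0$, then $$H^0(E(n,m))\cong\frac{\ker H^0(g(n,m))}{\operatorname{im} H^0(f(n,m))},\quad H^1(E(n,m))\cong\operatorname{coker} H^0(g(n,m)),\quad H^2(E(n,m))=0.$$ 2. If $H^1(\mathcal{M}^\bullet(n,m))\neq 0$, then $$H^0(E(n,m))\cong\ker H^1(f(n,m)),\quad H^1(E(n,m))\cong\frac{\ker H^1(g(n,m))}{\operatorname{im} H^1(f(n,m))},\quad H^2(E(n,m))\cong\operatorname{coker} H^1(g(n,m)).$$ 3. If $H^2(\mathcal{M}^\bullet(n,m))\neq 0$, then $$H^0(E(n,m))=0,\quad H^1(E(n,m))\cong\ker H^2(f(n,m)),\quad H^2(E(n,m))\cong\frac{\ker H^2(g(n,m))}{\operatorname{im} H^2(f(n,m))}.$$ -/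

import Mathlib

open CategoryTheory AlgebraicGeometry TopologicalSpace Opposite

noncomputable section

namespace MonadCohomology

/-! ### Sheaves of modules on a scheme: vector bundles and tensor products -/

/-- A sheaf of `𝒪_X`-modules is a vector bundle if every point has an open neighbourhood on which
the sheaf is isomorphic to `𝒪 ^ n` for some natural number `n`. -/
def IsVectorBundle {X : Scheme.{0}} (M : X.Modules) : Prop :=
  ∀ x : X, ∃ U : X.Opens, x ∈ U ∧ ∃ n : ℕ,
    Nonempty (M.restrict U.ι ≅
      (SheafOfModules.free (R := U.toScheme.ringCatSheaf) (Fin n) : U.toScheme.Modules))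

/-- The sheaf of modules associated with a presheaf of modules. -/
def associatedSheaf (X : Scheme.{0}) : X.PresheafOfModules ⥤ X.Modules :=
  PresheafOfModules.sheafification (𝟙 X.ringCatSheaf.obj)

/-- The functor `M ↦ (U ↦ M(U) ⊗_{𝒪(U)} L(U))` on presheaves of modules. -/
def presheafTensor {X : Scheme.{0}} (L : X.PresheafOfModules) :
    X.PresheafOfModules ⥤ X.PresheafOfModules :=
  MonoidalCategory.tensorRight (C := PresheafOfModules.{0} (X.presheaf ⋙ forget₂ _ _)) L

/-- The functor `M ↦ M ⊗ L` on sheaves of `𝒪_X`-modules: the sheaf associated with the presheaf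
`U ↦ M(U) ⊗_{𝒪(U)} L(U)`. -/
def tensorFunctor {X : Scheme.{0}} (L : X.Modules) : X.Modules ⥤ X.Modules :=
  Scheme.Modules.toPresheafOfModules X ⋙
    presheafTensor ((Scheme.Modules.toPresheafOfModules X).obj L) ⋙ associatedSheaf X

/-! ### Cohomology as `ℂ`-vector spaces -/

section Cohomology

variable {X : Scheme.{0}}

/-- Multiplication by a global function `a` on a sheaf of modules: `s ↦ a|_U • s` over `U`. -/
def scalar (M : X.Modules) (a : Γ(X, ⊤)) : M ⟶ M :=
  ⟨PresheafOfModules.homMk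
    { app := fun U ↦ AddCommGrpCat.ofHom
        (DistribSMul.toAddMonoidHom Γ(M, U.unop)
          (X.presheaf.map (homOfLE le_top : U.unop ⟶ ⊤).op a))
      naturality := by
        intro U V i
        ext s
        refine Eq.trans ?_ (Scheme.Modules.map_smul M i.unop
          (X.presheaf.map (homOfLE le_top : U.unop ⟶ ⊤).op a) s).symm
        rw [← CommRingCat.comp_apply, ← CategoryTheory.Functor.map_comp]
        rfl }
    (by
      intro U r s
      exact smul_comm (M := Γ(X, U.unop)) (N := Γ(X, U.unop)) (α := Γ(M, U.unop)) _ _ _)⟩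

lemma scalar_app (M : X.Modules) (a : Γ(X, ⊤)) (U : X.Opens) (s : Γ(M, U)) :
    (scalar M a).app U s = X.presheaf.map (homOfLE le_top : U ⟶ ⊤).op a • s := rfl

lemma scalar_one (M : X.Modules) : scalar M 1 = 𝟙 M := by
  apply Scheme.Modules.hom_ext
  intro U
  ext s
  rw [scalar_app]
  simp

lemma scalar_mul (M : X.Modules) (a b : Γ(X, ⊤)) :
    scalar M (a * b) = scalar M b ≫ scalar M a := by
  apply Scheme.Modules.hom_ext
  intro U
  ext s
  rw [scalar_app, Scheme.Modules.Hom.comp_app, map_mul, mul_smul]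
  rfl

lemma scalar_zero (M : X.Modules) : scalar M 0 = 0 := by
  apply Scheme.Modules.hom_ext
  intro U
  ext s
  rw [scalar_app]
  simp

lemma scalar_add (M : X.Modules) (a b : Γ(X, ⊤)) :
    scalar M (a + b) = scalar M a + scalar M b := by
  apply Scheme.Modules.hom_ext
  intro U
  ext s
  rw [scalar_app, map_add, add_smul]
  rfl

lemma scalar_naturality {M N : X.Modules} (φ : M ⟶ N) (a : Γ(X, ⊤)) :
    scalar M a ≫ φ = φ ≫ scalar N a := by
  apply Scheme.Modules.hom_ext
  intro U
  ext s
  exact Scheme.Modules.Hom.app_smul φ _ _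

/-- The underlying sheaf of abelian groups of a sheaf of modules. -/
def abSheaf (X : Scheme.{0}) :
    X.Modules ⥤ Sheaf (Opens.grothendieckTopology X) AddCommGrpCat.{0} :=
  SheafOfModules.toSheaf X.ringCatSheaf

/-- `H^i(X, M)` : the cohomology of the abelian sheaf underlying `M`. -/
def H (i : ℕ) (M : X.Modules) : Type :=
  Sheaf.H ((abSheaf X).obj M) i

instance (i : ℕ) (M : X.Modules) : AddCommGroup (H i M) :=
  inferInstanceAs (AddCommGroup (Sheaf.H ((abSheaf X).obj M) i))

/-- The map `H^i(X, M) → H^i(X, N)` induced by a morphism `M ⟶ N`, as an additive map. -/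
def mapAdd (i : ℕ) {M N : X.Modules} (φ : M ⟶ N) : H i M →+ H i N :=
  Sheaf.H.map ((abSheaf X).map φ) i

lemma mapAdd_id (i : ℕ) {M : X.Modules} (x : H i M) : mapAdd i (𝟙 M) x = x := by
  have h := congrArg (fun f ↦ Sheaf.H.map f i x) ((abSheaf X).map_id M)
  exact h.trans (Sheaf.H.map_id_apply (F := (abSheaf X).obj M) x)

lemma mapAdd_comp (i : ℕ) {M N K : X.Modules} (φ : M ⟶ N) (ψ : N ⟶ K) (x : H i M) :
    mapAdd i (φ ≫ ψ) x = mapAdd i ψ (mapAdd i φ x) := by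
  have h := congrArg (fun f ↦ Sheaf.H.map f i x) ((abSheaf X).map_comp φ ψ)
  exact h.trans (Sheaf.H.map_comp_apply (F := (abSheaf X).obj M) _ _ x)

lemma mapAdd_add (i : ℕ) {M N : X.Modules} (φ ψ : M ⟶ N) (x : H i M) :
    mapAdd i (φ + ψ) x = mapAdd i φ x + mapAdd i ψ x :=
  Sheaf.H.map_add_apply (F := (abSheaf X).obj M) ((abSheaf X).map φ) ((abSheaf X).map ψ) x

lemma mapAdd_zero (i : ℕ) {M N : X.Modules} (x : H i M) :
    mapAdd i (0 : M ⟶ N) x = 0 := by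
  have h := mapAdd_add i (0 : M ⟶ N) 0 x
  rw [add_zero] at h
  exact left_eq_add.mp h

/-- The action of global functions on cohomology, by functoriality. -/
def scalarH (i : ℕ) (M : X.Modules) : Γ(X, ⊤) →+* AddMonoid.End (H i M) where
  toFun a := mapAdd i (scalar M a)
  map_one' := by
    ext x
    rw [scalar_one]
    exact mapAdd_id i x
  map_mul' a b := by
    ext x
    rw [scalar_mul]
    exact mapAdd_comp i _ _ x
  map_zero' := by
    ext x
    rw [scalar_zero]
    exact mapAdd_zero i x
  map_add' a b := by
    ext x
    rw [scalar_add]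
    exact mapAdd_add i _ _ x

/-- The structure homomorphism `ℂ → Γ(X, 𝒪_X)` of a scheme over `ℂ`. -/
def constants (X : Scheme.{0}) [X.Over (Spec (.of ℂ))] : ℂ →+* Γ(X, ⊤) :=
  ((Scheme.ΓSpecIso (.of ℂ)).inv ≫ (X ↘ Spec (.of ℂ)).appTop).hom

variable [X.Over (Spec (.of ℂ))]

/-- For a scheme `X` over `ℂ`, a scalar `c : ℂ` acts on `H^i(X, M)` by the map induced by
multiplication by `c` on `M`. -/
instance (i : ℕ) (M : X.Modules) : Module ℂ (H i M) :=
  Module.compHom (H i M) ((scalarH i M).comp (constants X))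

/-- The `ℂ`-linear map `H^i(φ) : H^i(X, M) → H^i(X, N)` induced by a morphism `φ : M ⟶ N`. -/
def mapH (i : ℕ) {M N : X.Modules} (φ : M ⟶ N) : H i M →ₗ[ℂ] H i N where
  __ := mapAdd i φ
  map_smul' c x := by
    change mapAdd i φ (mapAdd i (scalar M (constants X c)) x) =
      mapAdd i (scalar N (constants X c)) (mapAdd i φ x)
    rw [← mapAdd_comp, ← mapAdd_comp, scalar_naturality]

end Cohomology


/-! ### The sheaves `𝒪(n)` on `Proj` -/

section Twist

variable {A σ : Type} [CommRing A] [SetLike σ A] [AddSubgroupClass σ A]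
variable (𝒜 : ℕ → σ) [GradedRing 𝒜]

/-- The complement of the homogeneous prime ideal given by a point of `Proj`. -/
abbrev primeCompl (x : ProjectiveSpectrum 𝒜) : Submonoid A :=
  x.asHomogeneousIdeal.toIdeal.primeCompl

lemma exists_homogeneous_notMem (x : ProjectiveSpectrum 𝒜) :
    ∃ (d : ℕ) (s : A), 0 < d ∧ s ∈ 𝒜 d ∧ s ∉ x.asHomogeneousIdeal := by
  classical
  by_contra! h
  refine x.not_irrelevant_le fun a ha ↦ ?_
  rw [HomogeneousIdeal.mem_irrelevant_iff] at ha
  change a ∈ x.asHomogeneousIdeal.toIdeal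
  rw [← DirectSum.sum_support_decompose 𝒜 a]
  refine Ideal.sum_mem _ fun d _ ↦ ?_
  rcases Nat.eq_zero_or_pos d with rfl | hd
  · rw [GradedRing.proj_apply] at ha
    rw [ha]
    exact Ideal.zero_mem _
  · exact h d _ hd (SetLike.coe_mem _)

/-- The localization `A_𝔭` at the homogeneous prime ideal `𝔭` given by a point of `Proj`. -/
abbrev LocalizationAt (x : ProjectiveSpectrum 𝒜) : Type :=
  Localization.AtPrime x.asHomogeneousIdeal.toIdeal

/-- A family of elements of the localizations `A_𝔭`, for `𝔭` in an open `U`, is given by a single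
fraction of degree `n` if it is `𝔭 ↦ a / b` with `a`, `b` homogeneous and `deg a - deg b = n`. -/
def IsFractionOfDegree (n : ℤ) {U : Opens (ProjectiveSpectrum.top 𝒜)}
    (f : ∀ x : U, LocalizationAt 𝒜 x.1) : Prop :=
  ∃ (i j : ℕ) (a : 𝒜 i) (b : 𝒜 j) (hb : ∀ x : U, b.1 ∉ x.1.asHomogeneousIdeal.toIdeal),
    (i : ℤ) - j = n ∧ ∀ x : U, f x = Localization.mk a.1 ⟨b.1, hb x⟩

/-- Families which are locally fractions of degree `n`. -/
def locallyFractionOfDegree (n : ℤ) :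
    TopCat.LocalPredicate (X := ProjectiveSpectrum.top 𝒜) fun x ↦ LocalizationAt 𝒜 x :=
  TopCat.PrelocalPredicate.sheafify
    { pred := fun f ↦ IsFractionOfDegree 𝒜 n f
      res := by
        rintro V U i f ⟨p, q, a, b, hb, h, w⟩
        exact ⟨p, q, a, b, (hb <| i ·), h, (w <| i ·)⟩ }

/-- The sections of `𝒪(n)` over `U`: families that are locally fractions of degree `n`. -/
def twistSections (n : ℤ) (U : Opens (ProjectiveSpectrum.top 𝒜)) :
    AddSubgroup (∀ x : U, LocalizationAt 𝒜 x.1) where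
  carrier := {f | (locallyFractionOfDegree 𝒜 n).pred f}
  zero_mem' := by
    intro x
    obtain ⟨d, s, hd, hs, hsx⟩ := exists_homogeneous_notMem 𝒜 x.1
    refine ⟨U ⊓ ProjectiveSpectrum.basicOpen 𝒜 s, ⟨x.2, hsx⟩, Opens.infLELeft _ _,
      (n + (n.natAbs * d : ℕ)).toNat, n.natAbs * d, 0, ⟨s ^ n.natAbs, ?_⟩, ?_, ?_, ?_⟩
    · simpa using SetLike.pow_mem_graded n.natAbs hs
    · exact fun y ↦ (primeCompl 𝒜 y.1).pow_mem y.2.2 _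
    · have : (n.natAbs : ℤ) ≤ (n.natAbs * d : ℕ) := by
        exact_mod_cast Nat.le_mul_of_pos_right _ hd
      omega
    · exact fun y ↦ (Localization.mk_zero _).symm
  add_mem' {f g} hf hg := by
    intro x
    obtain ⟨V, hV, iV, p, q, a, b, hb, h, w⟩ := hf x
    obtain ⟨W, hW, iW, p', q', a', b', hb', h', w'⟩ := hg x
    refine ⟨V ⊓ W, ⟨hV, hW⟩, Opens.infLELeft _ _ ≫ iV, q + p', q + q',
      ⟨b.1 * a'.1 + b'.1 * a.1, ?_⟩, ⟨b.1 * b'.1, SetLike.mul_mem_graded b.2 b'.2⟩,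
      fun y ↦ (primeCompl 𝒜 y.1).mul_mem (hb ⟨y.1, y.2.1⟩) (hb' ⟨y.1, y.2.2⟩),
      by push_cast; omega, ?_⟩
    · refine add_mem (SetLike.mul_mem_graded b.2 a'.2) ?_
      have e : q + p' = q' + p := by omega
      rw [e]
      exact SetLike.mul_mem_graded b'.2 a.2
    · rintro ⟨y, hy⟩
      have e₁ := w ⟨y, hy.1⟩
      have e₂ := w' ⟨y, hy.2⟩
      refine (congrArg₂ (· + ·) e₁ e₂).trans ?_
      exact Localization.add_mk _ _ _ _
  neg_mem' {f} hf := by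
    intro x
    obtain ⟨V, hV, iV, p, q, a, b, hb, h, w⟩ := hf x
    refine ⟨V, hV, iV, p, q, ⟨-a.1, neg_mem a.2⟩, b, hb, h, fun y ↦ ?_⟩
    exact (congrArg Neg.neg (w y)).trans (Localization.neg_mk _ _)

lemma smul_mem_twistSections (n : ℤ) (U : Opens (ProjectiveSpectrum.top 𝒜))
    (r : (ProjectiveSpectrum.Proj.structureSheaf 𝒜).1.obj (op U)) (f : twistSections 𝒜 n U) :
    (fun x ↦ (r.1 x).val * f.1 x) ∈ twistSections 𝒜 n U := by
  intro x
  obtain ⟨V, hV, iV, p, a, b, hb, w⟩ := r.2 x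
  obtain ⟨W, hW, iW, p', q', a', b', hb', h', w'⟩ := f.2 x
  refine ⟨V ⊓ W, ⟨hV, hW⟩, Opens.infLELeft _ _ ≫ iV, p + p', p + q',
    ⟨a.1 * a'.1, SetLike.mul_mem_graded a.2 a'.2⟩, ⟨b.1 * b'.1, SetLike.mul_mem_graded b.2 b'.2⟩,
    fun y ↦ (primeCompl 𝒜 y.1).mul_mem (hb ⟨y.1, y.2.1⟩) (hb' ⟨y.1, y.2.2⟩),
    by push_cast; omega, ?_⟩
  rintro ⟨y, hy⟩
  have e₁ := congrArg HomogeneousLocalization.val (w ⟨y, hy.1⟩)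
  rw [HomogeneousLocalization.val_mk] at e₁
  have e₂ := w' ⟨y, hy.2⟩
  exact (congrArg₂ (· * ·) e₁ e₂).trans (Localization.mk_mul _ _ _ _)

/-- A function acts on a section of `𝒪(n)` by multiplication in the localizations. -/
instance twistModule (n : ℤ) (U : (Opens (ProjectiveSpectrum.top 𝒜))ᵒᵖ) :
    Module ((ProjectiveSpectrum.Proj.structureSheaf 𝒜).1.obj U) (twistSections 𝒜 n U.unop) where
  smul r f := ⟨fun x ↦ (r.1 x).val * f.1 x, smul_mem_twistSections 𝒜 n U.unop r f⟩
  one_smul f := Subtype.ext <| funext fun x ↦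
    (congrArg (· * f.1 x) HomogeneousLocalization.val_one).trans (one_mul _)
  mul_smul r s f := Subtype.ext <| funext fun x ↦
    (congrArg (· * f.1 x) (HomogeneousLocalization.val_mul (r.1 x) (s.1 x))).trans
      (mul_assoc _ _ _)
  smul_zero _ := Subtype.ext <| funext fun _ ↦ mul_zero _
  smul_add _ _ _ := Subtype.ext <| funext fun _ ↦ mul_add _ _ _
  add_smul r s f := Subtype.ext <| funext fun x ↦
    (congrArg (· * f.1 x) (HomogeneousLocalization.val_add (r.1 x) (s.1 x))).trans
      (add_mul _ _ _)
  zero_smul f := Subtype.ext <| funext fun x ↦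
    (congrArg (· * f.1 x) HomogeneousLocalization.val_zero).trans (zero_mul _)

/-- `𝒪(n)` as a presheaf of abelian groups. -/
def twistAbPresheaf (n : ℤ) : TopCat.Presheaf AddCommGrpCat.{0} (ProjectiveSpectrum.top 𝒜) where
  obj U := AddCommGrpCat.of (twistSections 𝒜 n U.unop)
  map {U V} i := AddCommGrpCat.ofHom
    { toFun := fun f ↦ ⟨fun x ↦ f.1 (i.unop x), (locallyFractionOfDegree 𝒜 n).res i.unop f.1 f.2⟩
      map_zero' := rfl
      map_add' := fun _ _ ↦ rfl }

/-- The sheaf `𝒪(n)` on `Proj`. -/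
def twistingSheaf (n : ℤ) : (Proj 𝒜).Modules where
  val :=
    letI (U : (Opens (Proj 𝒜))ᵒᵖ) :
      Module ((Proj 𝒜).ringCatSheaf.obj.obj U) ((twistAbPresheaf 𝒜 n).obj U) :=
      twistModule 𝒜 n U
    PresheafOfModules.ofPresheaf (R := (Proj 𝒜).ringCatSheaf.obj) (twistAbPresheaf 𝒜 n)
      fun _ _ _ _ _ ↦ rfl
  isSheaf := (TopCat.Presheaf.isSheaf_iff_isSheaf_comp (forget AddCommGrpCat)
      (twistAbPresheaf 𝒜 n)).2
    (TopCat.subsheafToTypes (locallyFractionOfDegree 𝒜 n)).2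

end Twist

/-! ### `ℙ¹ × ℙ¹` over `ℂ` and its line bundles -/

/-- The grading of `ℂ[z₀, z₁]` by degree. -/
abbrev grading : ℕ → Submodule ℂ (MvPolynomial (Fin 2) ℂ) :=
  MvPolynomial.homogeneousSubmodule (Fin 2) ℂ

instance : GradedAlgebra grading := MvPolynomial.gradedAlgebra

/-- The complex projective line `ℙ¹ = Proj ℂ[z₀, z₁]`. -/
abbrev P1 : Scheme.{0} := Proj grading

/-- The structure morphism `ℙ¹ ⟶ Spec ℂ`. -/
def P1.structureMap : P1 ⟶ Spec (.of ℂ) :=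
  Proj.toSpecZero grading ≫ Spec.map (CommRingCat.ofHom (algebraMap ℂ (grading 0)))

/-- The line bundle `𝒪(n)` on `ℙ¹`. -/
def P1.lineBundle (n : ℤ) : P1.Modules := twistingSheaf grading n

/-- `ℙ¹ × ℙ¹`, the product over `Spec ℂ`. -/
def P1xP1 : Scheme.{0} := Limits.pullback P1.structureMap P1.structureMap

/-- The first projection `ℙ¹ × ℙ¹ ⟶ ℙ¹`. -/
def P1xP1.p : P1xP1 ⟶ P1 := Limits.pullback.fst _ _

/-- The second projection `ℙ¹ × ℙ¹ ⟶ ℙ¹`. -/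
def P1xP1.q : P1xP1 ⟶ P1 := Limits.pullback.snd _ _

instance : P1xP1.Over (Spec (.of ℂ)) := ⟨P1xP1.p ≫ P1.structureMap⟩

/-- The line bundle `𝒪(n, m) = p^* 𝒪(n) ⊗ q^* 𝒪(m)` on `ℙ¹ × ℙ¹`. -/
def P1xP1.lineBundle (n m : ℤ) : P1xP1.Modules :=
  (tensorFunctor ((Scheme.Modules.pullback P1xP1.q).obj (P1.lineBundle m))).obj
    ((Scheme.Modules.pullback P1xP1.p).obj (P1.lineBundle n))

/-- The functor `M ↦ M(n, m) = M ⊗ 𝒪(n, m)`. -/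
def twist (n m : ℤ) : P1xP1.Modules ⥤ P1xP1.Modules :=
  tensorFunctor (P1xP1.lineBundle n m)

/-! ### Monads -/

/-- A complex `A ⟶ B ⟶ C` of sheaves of modules (composition zero) is a monad if `A`, `B`, `C` are
vector bundles, `f : A ⟶ B` is an injective bundle map, i.e. a monomorphism of sheaves which is
injective on the fibre over every point `Spec κ(x) ⟶ X`, and `g : B ⟶ C` is surjective. -/
structure IsMonad {X : Scheme.{0}} (S : ShortComplex X.Modules) : Prop where
  vectorBundle₁ : IsVectorBundle S.X₁
  vectorBundle₂ : IsVectorBundle S.X₂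
  vectorBundle₃ : IsVectorBundle S.X₃
  mono : Mono S.f
  fibre_mono : ∀ x : X, Mono ((Scheme.Modules.pullback (X.fromSpecResidueField x)).map S.f)
  epi : Epi S.g

/-- The cohomology bundle `E = ker g / im f` of a monad. -/
def cohomologyBundle {X : Scheme.{0}} (S : ShortComplex X.Modules) : X.Modules := S.homology

/-- The cohomology `H^i(A(n, m)) ⊕ H^i(B(n, m)) ⊕ H^i(C(n, m))` of the terms of a twisted monad. -/
abbrev HMonad (i : ℕ) (S : ShortComplex P1xP1.Modules) (n m : ℤ) : Type :=
  H i ((twist n m).obj S.X₁) × H i ((twist n m).obj S.X₂) × H i ((twist n m).obj S.X₃)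

/-- A monad on `ℙ¹ × ℙ¹` has natural cohomology if for every twist `(n, m)` there is at most one
`i` for which the `i`-th cohomology of its terms is nonzero. -/
def HasNaturalCohomology (S : ShortComplex P1xP1.Modules) : Prop :=
  ∀ (n m : ℤ) (i j : ℕ), Nontrivial (HMonad i S n m) → Nontrivial (HMonad j S n m) → i = j

end MonadCohomology

end

open MonadCohomology

/-!
Let `A ⟶ B ⟶ C` be a monad with maps `f`, `g`, and put `K = ker g`. The display of the monad
consists of the short exact sequences `0 ⟶ K ⟶ B ⟶ C ⟶ 0` and `0 ⟶ A ⟶ K ⟶ E ⟶ 0`. Once both are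
known to stay exact after twisting, their long exact cohomology sequences give the result: when the
cohomology of `A(n, m)`, `B(n, m)` and `C(n, m)` lives in a single degree, all but a few terms
vanish, and what remains identifies `H^i(E(n, m))` with a kernel, a cokernel or a subquotient
(`cohomology_of_display_zero`, `cohomology_of_display_one`, `cohomology_of_display_two`). The
connecting maps are `ℂ`-linear because the extension class is natural for the endomorphisms of a
sequence given by constants (`connecting`).

The twisted sequences are exact because the sequences of the display are locally split, so that they
stay exact after tensoring with any sheaf of modules; no flatness of `𝒪(n, m)` is needed. Here a
sequence is called locally split when, for all sufficiently small open sets `V`, its sections over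
`V` form a split exact sequence of modules. Such a sequence stays split after applying `- ⊗ L(V)`,
and sheafification turns a sequence of presheaves that is exact over small open sets into an exact one
(`IsLocallySplit.shortExact_tensor`).

* For `0 ⟶ K ⟶ B ⟶ C ⟶ 0`: near a point, `C` has a frame, that is, sections which form a basis
  over every smaller open set. After shrinking, the frame lifts to `B`
  (`isLocallySplit_of_isVectorBundle`).
* For `0 ⟶ A ⟶ K ⟶ E ⟶ 0`: injectivity of `f` on the fibre at `x` says that the matrix of `f` in
  local frames has linearly independent rows at `x` (`eq_zero_of_mono_pullback`), hence has a right
  inverse near `x` (`exists_right_inverse_near`). This gives a retraction of `f`, and so of `A ⟶ K`,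
  on a neighbourhood (`exists_retractionOn`), which also lets local lifts of sections of `E` be glued
  (`RetractionOn.surjective`).
-/

noncomputable section

namespace MonadCohomology

/-! ### Subquotients from exact sequences -/

section LinearAlgebra

variable {k : Type*} [Field k]
variable {A B C K E : Type*} [AddCommGroup A] [AddCommGroup B] [AddCommGroup C] [AddCommGroup K]
  [AddCommGroup E] [Module k A] [Module k B] [Module k C] [Module k K] [Module k E]

lemma nonempty_equiv_ker_quotient_range {f : A →ₗ[k] B} {g : B →ₗ[k] C} {u : A →ₗ[k] K}
    {v : K →ₗ[k] E} {j : K →ₗ[k] B} (hf : f = j ∘ₗ u) (hj : Function.Injective j)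
    (hjg : Function.Exact j g) (huv : Function.Exact u v) (hv : Function.Surjective v) :
    Nonempty (E ≃ₗ[k] (LinearMap.ker g ⧸ (LinearMap.range f).submoduleOf (LinearMap.ker g))) := by
  have hker : LinearMap.range j = LinearMap.ker g := (LinearMap.exact_iff.mp hjg).symm
  let e : K ≃ₗ[k] LinearMap.ker g :=
    (LinearEquiv.ofInjective j hj).trans (LinearEquiv.ofEq _ _ hker)
  have he : ∀ x, (e x : B) = j x := fun x ↦ rfl
  refine ⟨(v.quotKerEquivOfSurjective hv).symm.trans (Submodule.Quotient.equiv _ _ e ?_)⟩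
  ext ⟨y, hy⟩
  rw [LinearMap.exact_iff.mp huv, Submodule.mem_map]
  change _ ↔ y ∈ LinearMap.range f
  constructor
  · rintro ⟨_, ⟨a, rfl⟩, h⟩
    exact ⟨a, by rw [hf]; exact (he _).symm.trans (congrArg Subtype.val h)⟩
  · rintro ⟨a, ha⟩
    exact ⟨u a, ⟨a, rfl⟩, Subtype.ext ((he _).trans ((congrArg (fun φ ↦ φ a) hf.symm).trans ha))⟩

lemma nonempty_equiv_coker {g : B →ₗ[k] C} {δ : C →ₗ[k] K} {v : K →ₗ[k] E}
    (hg : Function.Exact g δ) (hδ : Function.Surjective δ) (hv : Function.Bijective v) :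
    Nonempty (E ≃ₗ[k] (C ⧸ LinearMap.range g)) :=
  ⟨(LinearEquiv.ofBijective v hv).symm.trans ((δ.quotKerEquivOfSurjective hδ).symm.trans
    (Submodule.quotEquivOfEq _ _ (LinearMap.exact_iff.mp hg)))⟩

lemma nonempty_equiv_ker {f : A →ₗ[k] B} {u : A →ₗ[k] K} {j : K →ₗ[k] B} {δ : E →ₗ[k] A}
    (hf : f = j ∘ₗ u) (hj : Function.Injective j) (hδ : Function.Injective δ)
    (h : Function.Exact δ u) : Nonempty (E ≃ₗ[k] LinearMap.ker f) := by
  refine ⟨(LinearEquiv.ofInjective δ hδ).trans (LinearEquiv.ofEq _ _ ?_)⟩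
  rw [hf, LinearMap.ker_comp_of_ker_eq_bot _ (LinearMap.ker_eq_bot.mpr hj)]
  exact (LinearMap.exact_iff.mp h).symm

lemma surjective_of_exact [Subsingleton C] {u : A →ₗ[k] B}
    {v : B →ₗ[k] C} (h : Function.Exact u v) : Function.Surjective u :=
  fun y ↦ (h y).mp (Subsingleton.elim _ _)

lemma injective_of_exact [Subsingleton A] {u : A →ₗ[k] B}
    {v : B →ₗ[k] C} (h : Function.Exact u v) : Function.Injective v := by
  refine (injective_iff_map_eq_zero v).mpr fun y hy ↦ ?_
  obtain ⟨x, rfl⟩ := (h y).mp hy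
  rw [Subsingleton.elim x 0, map_zero]

lemma subsingleton_of_exact [Subsingleton A] [Subsingleton C]
    {u : A →ₗ[k] B} {v : B →ₗ[k] C} (h : Function.Exact u v) : Subsingleton B :=
  (injective_of_exact h).subsingleton

end LinearAlgebra

/-! ### The long exact cohomology sequence -/

section LongExactSequence

variable {X : Scheme.{0}}

/-- The endomorphism of a complex of sheaves of modules given by a global function. -/
def scalarComplex (S : ShortComplex X.Modules) (a : Γ(X, ⊤)) : S ⟶ S where
  τ₁ := scalar S.X₁ a
  τ₂ := scalar S.X₂ a
  τ₃ := scalar S.X₃ a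
  comm₁₂ := scalar_naturality _ _
  comm₂₃ := scalar_naturality _ _

instance : (abSheaf X).Additive := inferInstanceAs (SheafOfModules.toSheaf _).Additive

variable [X.Over (Spec (.of ℂ))] {M N K : X.Modules} {φ : M ⟶ N} {ψ : N ⟶ K}
  {w : φ ≫ ψ = 0}

/-- The connecting map of the long exact cohomology sequence. It is `ℂ`-linear because the
extension class is natural for the endomorphisms of `S` given by the constants. -/
def connecting (hS : ((ShortComplex.mk φ ψ w).map (abSheaf X)).ShortExact)
    {i j : ℕ} (hij : i + 1 = j) :
    H i K →ₗ[ℂ] H j M where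
  __ := (hS.extClass.postcomp _ hij :
    Sheaf.H ((abSheaf X).obj K) i →+ Sheaf.H ((abSheaf X).obj M) j)
  map_smul' c x := by
    have h := ShortComplex.ShortExact.extClass_naturality hS hS
      ((abSheaf X).mapShortComplex.map (scalarComplex (ShortComplex.mk φ ψ w) (constants X c)))
    exact (Abelian.Ext.comp_assoc_of_second_deg_zero
      (X := (constantSheaf (Opens.grothendieckTopology X) AddCommGrpCat).obj
        (AddCommGrpCat.of (ULift ℤ))) x
      (.mk₀ ((abSheaf X).map (scalar K (constants X c)))) hS.extClass hij).trans
      ((congrArg (fun y ↦ Abelian.Ext.comp x y hij) h.symm).trans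
      (Abelian.Ext.comp_assoc_of_third_deg_zero
        (X := (constantSheaf (Opens.grothendieckTopology X) AddCommGrpCat).obj
        (AddCommGrpCat.of (ULift ℤ))) x hS.extClass
        (.mk₀ ((abSheaf X).map (scalar M (constants X c)))) hij).symm)

lemma exact_mapH (hS : ((ShortComplex.mk φ ψ w).map (abSheaf X)).ShortExact) (i : ℕ) :
    Function.Exact (mapH i φ) (mapH i ψ) :=
  (ShortComplex.ab_exact_iff_function_exact _).mp
    (Abelian.Ext.covariant_sequence_exact₂' _ hS i)

lemma exact_mapH_connecting (hS : ((ShortComplex.mk φ ψ w).map (abSheaf X)).ShortExact)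
    {i j : ℕ} (hij : i + 1 = j) :
    Function.Exact (mapH i ψ) (connecting hS hij) :=
  (ShortComplex.ab_exact_iff_function_exact _).mp
    (Abelian.Ext.covariant_sequence_exact₃' _ hS i j hij)

lemma exact_connecting_mapH (hS : ((ShortComplex.mk φ ψ w).map (abSheaf X)).ShortExact)
    {i j : ℕ} (hij : i + 1 = j) :
    Function.Exact (connecting hS hij) (mapH j φ) :=
  (ShortComplex.ab_exact_iff_function_exact _).mp
    (Abelian.Ext.covariant_sequence_exact₁' _ hS i j hij)

lemma injective_mapH_zero (hS : ((ShortComplex.mk φ ψ w).map (abSheaf X)).ShortExact) :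
    Function.Injective (mapH 0 φ) :=
  haveI : Mono ((abSheaf X).map φ) := hS.mono_f
  Abelian.Ext.postcomp_mk₀_injective_of_mono _ ((abSheaf X).map φ)

lemma mapH_comp (i : ℕ) (φ : M ⟶ N) (ψ : N ⟶ K) :
    mapH i (φ ≫ ψ) = mapH i ψ ∘ₗ mapH i φ :=
  LinearMap.ext (mapAdd_comp i φ ψ)

end LongExactSequence

/-! ### Cohomology of a display with terms concentrated in one degree -/

section Display

variable {X : Scheme.{0}} [X.Over (Spec (.of ℂ))]
variable {A B C K E : X.Modules} {u : A ⟶ K} {v : K ⟶ E} {j : K ⟶ B} {g : B ⟶ C}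
  {huv : u ≫ v = 0} {hjg : j ≫ g = 0}

/-- For sequences `0 ⟶ K ⟶ B ⟶ C ⟶ 0` and `0 ⟶ A ⟶ K ⟶ E ⟶ 0` whose terms `A`, `B`, `C` have
cohomology in degree `0` only: the first sequence computes `H^i(K)`, the second then `H^i(E)`. -/
lemma cohomology_of_display_zero
    (h₁ : ((ShortComplex.mk j g hjg).map (abSheaf X)).ShortExact)
    (h₂ : ((ShortComplex.mk u v huv).map (abSheaf X)).ShortExact)
    {f : A ⟶ B} (hf : f = u ≫ j)
    (hvan : ∀ i : ℕ, i ≠ 0 → Subsingleton (H i A) ∧ Subsingleton (H i B) ∧ Subsingleton (H i C)) :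
    Nonempty (H 0 E ≃ₗ[ℂ] (LinearMap.ker (mapH 0 g) ⧸
      (LinearMap.range (mapH 0 f)).submoduleOf (LinearMap.ker (mapH 0 g)))) ∧
    Nonempty (H 1 E ≃ₗ[ℂ] (H 0 C ⧸ LinearMap.range (mapH 0 g))) ∧
    Subsingleton (H 2 E) := by
  obtain ⟨_, _, _⟩ := hvan 1 one_ne_zero
  obtain ⟨_, _, _⟩ := hvan 2 two_ne_zero
  obtain ⟨_, _, _⟩ := hvan 3 three_ne_zero
  have : Subsingleton (H 2 K) :=
    subsingleton_of_exact (k := ℂ) (C := H 2 B) (exact_connecting_mapH h₁ one_add_one_eq_two)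
  refine ⟨?_, ?_, ?_⟩
  · exact nonempty_equiv_ker_quotient_range (by rw [hf, mapH_comp]) (injective_mapH_zero h₁)
      (exact_mapH h₁ 0) (exact_mapH h₂ 0)
      (surjective_of_exact (C := H 1 A) (exact_mapH_connecting h₂ (zero_add 1)))
  · exact nonempty_equiv_coker (exact_mapH_connecting h₁ (zero_add 1))
      (surjective_of_exact (C := H 1 B) (exact_connecting_mapH h₁ (zero_add 1)))
      ⟨injective_of_exact (A := H 1 A) (exact_mapH h₂ 1),
        surjective_of_exact (C := H 2 A) (exact_mapH_connecting h₂ one_add_one_eq_two)⟩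
  · exact subsingleton_of_exact (k := ℂ) (A := H 2 K) (C := H 3 A)
      (exact_mapH_connecting h₂ two_add_one_eq_three)

/-- The variant of `cohomology_of_display_zero` for cohomology in degree `1` only. -/
lemma cohomology_of_display_one
    (h₁ : ((ShortComplex.mk j g hjg).map (abSheaf X)).ShortExact)
    (h₂ : ((ShortComplex.mk u v huv).map (abSheaf X)).ShortExact)
    {f : A ⟶ B} (hf : f = u ≫ j)
    (hvan : ∀ i : ℕ, i ≠ 1 → Subsingleton (H i A) ∧ Subsingleton (H i B) ∧ Subsingleton (H i C)) :
    Nonempty (H 0 E ≃ₗ[ℂ] LinearMap.ker (mapH 1 f)) ∧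
    Nonempty (H 1 E ≃ₗ[ℂ] (LinearMap.ker (mapH 1 g) ⧸
      (LinearMap.range (mapH 1 f)).submoduleOf (LinearMap.ker (mapH 1 g)))) ∧
    Nonempty (H 2 E ≃ₗ[ℂ] (H 1 C ⧸ LinearMap.range (mapH 1 g))) := by
  obtain ⟨_, _, _⟩ := hvan 0 zero_ne_one
  obtain ⟨_, _, _⟩ := hvan 2 (by decide)
  obtain ⟨_, _, _⟩ := hvan 3 (by decide)
  have : Subsingleton (H 0 K) := (injective_mapH_zero h₁).subsingleton
  have hj : Function.Injective (mapH 1 j) :=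
    injective_of_exact (A := H 0 C) (exact_connecting_mapH h₁ (zero_add 1))
  refine ⟨?_, ?_, ?_⟩
  · exact nonempty_equiv_ker (by rw [hf, mapH_comp]) hj
      (injective_of_exact (A := H 0 K) (exact_mapH_connecting h₂ (zero_add 1)))
      (exact_connecting_mapH h₂ (zero_add 1))
  · exact nonempty_equiv_ker_quotient_range (by rw [hf, mapH_comp]) hj
      (exact_mapH h₁ 1) (exact_mapH h₂ 1)
      (surjective_of_exact (C := H 2 A) (exact_mapH_connecting h₂ one_add_one_eq_two))
  · exact nonempty_equiv_coker (exact_mapH_connecting h₁ one_add_one_eq_two)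
      (surjective_of_exact (C := H 2 B) (exact_connecting_mapH h₁ one_add_one_eq_two))
      ⟨injective_of_exact (A := H 2 A) (exact_mapH h₂ 2),
        surjective_of_exact (C := H 3 A)
      (exact_mapH_connecting h₂ two_add_one_eq_three)⟩

/-- The variant of `cohomology_of_display_zero` for cohomology in degree `2` only. -/
lemma cohomology_of_display_two
    (h₁ : ((ShortComplex.mk j g hjg).map (abSheaf X)).ShortExact)
    (h₂ : ((ShortComplex.mk u v huv).map (abSheaf X)).ShortExact)
    {f : A ⟶ B} (hf : f = u ≫ j)
    (hvan : ∀ i : ℕ, i ≠ 2 → Subsingleton (H i A) ∧ Subsingleton (H i B) ∧ Subsingleton (H i C)) :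
    Subsingleton (H 0 E) ∧
    Nonempty (H 1 E ≃ₗ[ℂ] LinearMap.ker (mapH 2 f)) ∧
    Nonempty (H 2 E ≃ₗ[ℂ] (LinearMap.ker (mapH 2 g) ⧸
      (LinearMap.range (mapH 2 f)).submoduleOf (LinearMap.ker (mapH 2 g)))) := by
  obtain ⟨_, _, _⟩ := hvan 0 (by decide)
  obtain ⟨_, _, _⟩ := hvan 1 (by decide)
  obtain ⟨_, _, _⟩ := hvan 3 (by decide)
  have : Subsingleton (H 0 K) := (injective_mapH_zero h₁).subsingleton
  have : Subsingleton (H 1 K) :=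
    subsingleton_of_exact (k := ℂ) (A := H 0 C) (C := H 1 B) (exact_connecting_mapH h₁ (zero_add 1))
  have hj : Function.Injective (mapH 2 j) :=
    injective_of_exact (A := H 1 C) (exact_connecting_mapH h₁ one_add_one_eq_two)
  refine ⟨?_, ?_, ?_⟩
  · exact subsingleton_of_exact (k := ℂ) (A := H 0 K) (C := H 1 A)
      (exact_mapH_connecting h₂ (zero_add 1))
  · exact nonempty_equiv_ker (by rw [hf, mapH_comp]) hj
      (injective_of_exact (A := H 1 K) (exact_mapH_connecting h₂ one_add_one_eq_two))
      (exact_connecting_mapH h₂ one_add_one_eq_two)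
  · exact nonempty_equiv_ker_quotient_range (by rw [hf, mapH_comp]) hj
      (exact_mapH h₁ 2) (exact_mapH h₂ 2)
      (surjective_of_exact (C := H 3 A)
      (exact_mapH_connecting h₂ two_add_one_eq_three))

end Display

/-! ### Sheafification of locally exact sequences -/

section Sheafification

variable {T : Type} [TopologicalSpace T]

/-- A presheaf whose sections vanish over all small open sets has zero sheafification. -/
lemma isZero_presheafToSheaf_of_locally (Q : (Opens T)ᵒᵖ ⥤ AddCommGrpCat.{0})
    (h : ∀ x : T, ∃ U : Opens T, x ∈ U ∧ ∀ V ≤ U, Limits.IsZero (Q.obj (op V))) :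
    Limits.IsZero ((presheafToSheaf (Opens.grothendieckTopology T) AddCommGrpCat).obj Q) := by
  rw [Limits.IsZero.iff_id_eq_zero]
  apply ((sheafificationAdjunction (Opens.grothendieckTopology T)
    AddCommGrpCat).homEquiv _ _).injective
  ext ⟨V⟩ s
  let F := (presheafToSheaf (Opens.grothendieckTopology T) AddCommGrpCat).obj Q
  choose U hxU hU using h
  refine TopCat.Sheaf.eq_of_locally_eq' (X := TopCat.of T) (F := F)
    (fun x : V ↦ U x ⊓ V) V (fun x ↦ homOfLE inf_le_right) ?_ _ _ ?_
  · intro x hx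
    exact Opens.mem_iSup.mpr ⟨⟨x, hx⟩, hxU _, hx⟩
  · intro x
    let i : op V ⟶ op (U x ⊓ V) := (homOfLE inf_le_right).op
    have hs : Q.map i s = 0 :=
      (AddCommGrpCat.subsingleton_of_isZero (hU x _ inf_le_left)).elim _ _
    have key : ∀ φ : Q ⟶ F.obj, F.obj.map i (φ.app (op V) s) = 0 := by
      intro φ
      rw [← NatTrans.naturality_apply, hs, map_zero]
    exact (key _).trans (key _).symm

/-- Sheafification turns a complex of presheaves that is exact over all small open sets into an
exact complex of sheaves. -/
lemma exact_presheafToSheaf_of_locally (P : ShortComplex ((Opens T)ᵒᵖ ⥤ AddCommGrpCat.{0}))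
    (h : ∀ x : T, ∃ U : Opens T, x ∈ U ∧
      ∀ V ≤ U, (P.map ((evaluation _ _).obj (op V))).Exact) :
    (P.map (presheafToSheaf (Opens.grothendieckTopology T) AddCommGrpCat)).Exact := by
  rw [ShortComplex.exact_iff_isZero_homology]
  refine (isZero_presheafToSheaf_of_locally P.homology fun x ↦ ?_).of_iso
    (P.mapHomologyIso (presheafToSheaf (Opens.grothendieckTopology T) AddCommGrpCat))
  obtain ⟨U, hxU, hU⟩ := h x
  refine ⟨U, hxU, fun V hV ↦ ?_⟩
  exact ((ShortComplex.exact_iff_isZero_homology _).mp (hU V hV)).of_iso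
    (P.mapHomologyIso ((evaluation _ _).obj (op V))).symm

/-- The variant of `exact_presheafToSheaf_of_locally` for short exact sequences; injectivity and
surjectivity are exactness of `0 ⟶ P₁ ⟶ P₂` and of `P₂ ⟶ P₃ ⟶ 0`, with zero maps in place of zero
objects. -/
lemma shortExact_presheafToSheaf_of_locally (P : ShortComplex ((Opens T)ᵒᵖ ⥤ AddCommGrpCat.{0}))
    (h : ∀ x : T, ∃ U : Opens T, x ∈ U ∧
      ∀ V ≤ U, (P.map ((evaluation _ _).obj (op V))).ShortExact) :
    (P.map (presheafToSheaf (Opens.grothendieckTopology T) AddCommGrpCat)).ShortExact where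
  exact := exact_presheafToSheaf_of_locally P fun x ↦
    let ⟨U, hxU, hU⟩ := h x
    ⟨U, hxU, fun V hV ↦ (hU V hV).exact⟩
  mono_f := by
    refine (ShortComplex.exact_iff_mono _ (Functor.map_zero _ _ _)).mp
      (exact_presheafToSheaf_of_locally (ShortComplex.mk (0 : P.X₁ ⟶ P.X₁) P.f (by simp))
        fun x ↦ ?_)
    obtain ⟨U, hxU, hU⟩ := h x
    exact ⟨U, hxU, fun V hV ↦ (ShortComplex.exact_iff_mono _ rfl).mpr (hU V hV).mono_f⟩
  epi_g := by
    refine (ShortComplex.exact_iff_epi _ (Functor.map_zero _ _ _)).mp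
      (exact_presheafToSheaf_of_locally (ShortComplex.mk P.g (0 : P.X₃ ⟶ P.X₃) (by simp))
        fun x ↦ ?_)
    obtain ⟨U, hxU, hU⟩ := h x
    exact ⟨U, hxU, fun V hV ↦ (ShortComplex.exact_iff_epi _ rfl).mpr (hU V hV).epi_g⟩

end Sheafification

/-! ### Tensoring locally split sequences -/

section LocallySplit

variable {X : Scheme.{0}}

/-- The functor `M ↦ Γ(M, V)` to modules over the commutative ring `Γ(X, V)`. -/
def sectionsFunctor (V : X.Opens) : X.Modules ⥤ ModuleCat.{0} Γ(X, V) :=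
  Scheme.Modules.toPresheafOfModules X ⋙
    PresheafOfModules.evaluation (X.presheaf ⋙ forget₂ _ _) (op V)

instance (V : X.Opens) : (sectionsFunctor V).PreservesZeroMorphisms where
  map_zero _ _ := rfl

/-- A complex of sheaves of modules is locally split if every point has a neighbourhood `U` such
that, for each open `V ⊆ U`, the complex of `Γ(X, V)`-modules of sections over `V` is a split short
exact sequence. The splittings are not required to be compatible with restriction. -/
def IsLocallySplit (S : ShortComplex X.Modules) : Prop :=
  ∀ x : X, ∃ U : X.Opens, x ∈ U ∧ ∀ V ≤ U, Nonempty (S.map (sectionsFunctor V)).Splitting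

instance (L : X.PresheafOfModules) : (presheafTensor L).PreservesZeroMorphisms where
  map_zero M N := by
    apply PresheafOfModules.hom_ext
    intro U
    exact MonoidalPreadditive.zero_whiskerRight (C := ModuleCat Γ(X, U.unop))
      (X := L.obj U) (Y := M.obj U) (Z := N.obj U)

instance : (associatedSheaf X).PreservesZeroMorphisms where
  map_zero M N := by
    apply (SheafOfModules.toSheaf X.ringCatSheaf).map_injective
    exact Functor.map_zero (presheafToSheaf (Opens.grothendieckTopology X) AddCommGrpCat)
      M.presheaf N.presheaf

instance : (Scheme.Modules.toPresheafOfModules X).PreservesZeroMorphisms where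
  map_zero _ _ := rfl

instance (L : X.Modules) : (tensorFunctor L).PreservesZeroMorphisms :=
  inferInstanceAs (Scheme.Modules.toPresheafOfModules X ⋙
    presheafTensor ((Scheme.Modules.toPresheafOfModules X).obj L) ⋙
      associatedSheaf X).PreservesZeroMorphisms

instance (n m : ℤ) : (twist n m).PreservesZeroMorphisms :=
  inferInstanceAs (tensorFunctor _).PreservesZeroMorphisms

/-- Tensoring a locally split sequence with any sheaf of modules keeps it exact: over small open
sets the presheaf tensor product of a split sequence is split, and sheafification is exact. -/
lemma IsLocallySplit.shortExact_tensor {S : ShortComplex X.Modules} (hS : IsLocallySplit S)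
    (L : X.Modules) : ((S.map (tensorFunctor L)).map (abSheaf X)).ShortExact := by
  let P : ShortComplex ((Opens X)ᵒᵖ ⥤ AddCommGrpCat.{0}) :=
    ((S.map (Scheme.Modules.toPresheafOfModules X)).map
      (presheafTensor ((Scheme.Modules.toPresheafOfModules X).obj L))).map
        (PresheafOfModules.toPresheaf _)
  refine shortExact_presheafToSheaf_of_locally P fun x ↦ ?_
  obtain ⟨U, hxU, hU⟩ := hS x
  refine ⟨U, hxU, fun V hV ↦ ?_⟩
  obtain ⟨s⟩ := hU V hV
  exact ((s.map (MonoidalCategory.tensorRight ((sectionsFunctor V).obj L))).map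
    (forget₂ (ModuleCat Γ(X, V)) AddCommGrpCat)).shortExact

end LocallySplit

/-! ### Frames of vector bundles -/

section Frames

variable {X : Scheme.{0}}

/-- The restriction of a section of a sheaf of modules to a smaller open set. -/
def res (M : X.Modules) {U V : X.Opens} (h : V ≤ U) : Γ(M, U) →+ Γ(M, V) :=
  (M.presheaf.map (homOfLE h).op).hom

/-- The restriction of a function to a smaller open set. -/
def resRing {U V : X.Opens} (h : V ≤ U) : Γ(X, U) →+* Γ(X, V) :=
  (X.presheaf.map (homOfLE h).op).hom

lemma res_res (M : X.Modules) {U V W : X.Opens} (h : V ≤ U) (h' : W ≤ V) (s : Γ(M, U)) :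
    res M h' (res M h s) = res M (h'.trans h) s := by
  simp only [res]
  rw [← AddCommGrpCat.comp_apply, ← Functor.map_comp]
  rfl

lemma resRing_resRing {U V W : X.Opens} (h : V ≤ U) (h' : W ≤ V) (s : Γ(X, U)) :
    resRing h' (resRing h s) = resRing (h'.trans h) s := by
  simp only [resRing]
  rw [← CommRingCat.comp_apply, ← Functor.map_comp]
  rfl

lemma res_smul (M : X.Modules) {U V : X.Opens} (h : V ≤ U) (a : Γ(X, U)) (s : Γ(M, U)) :
    res M h (a • s) = resRing h a • res M h s :=
  Scheme.Modules.map_smul M (homOfLE h) a s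

/-- A morphism of sheaves of modules as a linear map on sections. -/
def appLin {M N : X.Modules} (φ : M ⟶ N) (V : X.Opens) : Γ(M, V) →ₗ[Γ(X, V)] Γ(N, V) where
  __ := (φ.app V).hom
  map_smul' r x := Scheme.Modules.Hom.app_smul φ r x

lemma appLin_res {M N : X.Modules} (φ : M ⟶ N) {U V : X.Opens} (h : V ≤ U) (s : Γ(M, U)) :
    appLin φ V (res M h s) = res N h (appLin φ U s) :=
  NatTrans.naturality_apply φ.mapPresheaf (homOfLE h).op s

/-- Sections `e i` of `M` over `U` form a frame if they restrict to a basis of the module of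
sections over every open subset of `U`. -/
def IsFrame {M : X.Modules} {U : X.Opens} {n : ℕ} (e : Fin n → Γ(M, U)) : Prop :=
  ∀ (V : X.Opens) (h : V ≤ U),
    Function.Bijective (Fintype.linearCombination Γ(X, V) fun i ↦ res M h (e i))

variable {M N : X.Modules} {U : X.Opens} {n : ℕ} {e : Fin n → Γ(M, U)}

lemma IsFrame.restrict (he : IsFrame e) {V : X.Opens} (h : V ≤ U) :
    IsFrame fun i ↦ res M h (e i) := by
  intro W hW
  simp only [res_res]
  exact he W (hW.trans h)

/-- The coordinates of a section with respect to a frame. -/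
def IsFrame.coord (he : IsFrame e) {V : X.Opens} (h : V ≤ U) :
    Γ(M, V) ≃ₗ[Γ(X, V)] (Fin n → Γ(X, V)) :=
  (LinearEquiv.ofBijective _ (he V h)).symm

lemma IsFrame.sum_coord (he : IsFrame e) {V : X.Opens} (h : V ≤ U) (s : Γ(M, V)) :
    ∑ i, he.coord h s i • res M h (e i) = s :=
  (LinearEquiv.ofBijective _ (he V h)).apply_symm_apply s

lemma IsFrame.coord_sum (he : IsFrame e) {V : X.Opens} (h : V ≤ U) (a : Fin n → Γ(X, V)) :
    he.coord h (∑ i, a i • res M h (e i)) = a :=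
  (LinearEquiv.ofBijective _ (he V h)).symm_apply_apply a

lemma IsFrame.coord_res (he : IsFrame e) {V W : X.Opens} (h : V ≤ U) (h' : W ≤ V) (s : Γ(M, V))
    (i : Fin n) : he.coord (h'.trans h) (res M h' s) i = resRing h' (he.coord h s i) := by
  have : res M h' s = ∑ i, resRing h' (he.coord h s i) • res M (h'.trans h) (e i) := by
    conv_lhs => rw [← he.sum_coord h s]
    simp only [map_sum, res_smul, res_res]
  rw [this, he.coord_sum]

end Frames

/-! ### Existence of frames -/

section Existence

/-- The summand inclusions and projections of a finite copower in a preadditive category. -/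
lemma exists_projections {C : Type*} [Category* C] [Preadditive C] [Limits.HasCoproducts.{0} C]
    {M O : C} {n : ℕ} (α : M ≅ ∐ fun _ : Fin n ↦ O)  :
    ∃ (i : Fin n → (O ⟶ M)) (p : Fin n → (M ⟶ O)),
      (∀ j k, i j ≫ p k = if j = k then 𝟙 O else 0) ∧ ∑ k, p k ≫ i k = 𝟙 M := by
  refine ⟨fun j ↦ Limits.Sigma.ι (fun _ : Fin n ↦ O) j ≫ α.inv,
    fun k ↦ α.hom ≫ Limits.Sigma.desc fun j ↦ if j = k then 𝟙 O else 0, fun j k ↦ by simp, ?_⟩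
  rw [← cancel_epi α.inv]
  refine Limits.Sigma.hom_ext _ _ fun j ↦ ?_
  rw [Preadditive.comp_sum, Preadditive.comp_sum, Finset.sum_eq_single j]
  · simp
  · intro k _ hk
    simp [hk.symm]
  · simp

variable {X : Scheme.{0}}

/-- An isomorphism with a free sheaf of modules over `U` gives a frame over `U`. Its sections are
the images of `1` under the summand inclusions, and the coordinates are given by the projections. -/
lemma exists_isFrame_of_iso {M : X.Modules} {U : X.Opens} {n : ℕ}
    (α : M.restrict U.ι ≅
      (SheafOfModules.free (R := U.toScheme.ringCatSheaf) (Fin n) : U.toScheme.Modules)) :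
    ∃ e : Fin n → Γ(M, U), IsFrame e := by
  let O : U.toScheme.Modules := SheafOfModules.unit U.toScheme.ringCatSheaf
  obtain ⟨i, p, hip, hsum⟩ := exists_projections (O := O) α
  let I (V : U.toScheme.Opens) (j : Fin n) :
      Γ(X, U.ι ''ᵁ V) →ₗ[Γ(X, U.ι ''ᵁ V)] Γ(M, U.ι ''ᵁ V) :=
    { toFun a := (i j).app V (show Γ(O, V) from a)
      map_add' a b := map_add ((i j).app V).hom (show Γ(O, V) from a) (show Γ(O, V) from b)
      map_smul' r a := by
        refine (Scheme.Modules.Hom.app_smul (i j) (show Γ(U.toScheme, V) from r)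
          (show Γ(O, V) from a)).trans ?_
        change ((U.ι.appIso V).inv r • (show Γ(M, U.ι ''ᵁ V) from _) : Γ(M, U.ι ''ᵁ V)) = _
        rw [Scheme.Opens.ι_appIso]
        rfl }
  let P (V : U.toScheme.Opens) (k : Fin n) : Γ(M, U.ι ''ᵁ V) →+ Γ(X, U.ι ''ᵁ V) :=
    ((p k).app V).hom
  have hIP (V : U.toScheme.Opens) (j k : Fin n) (a) :
      P V k (I V j a) = if j = k then a else 0 := by
    have := congr($(hip j k).app V (show Γ(O, V) from a))
    refine this.trans ?_
    split_ifs <;> rfl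
  have hsum' (V : U.toScheme.Opens) (s : Γ(M, U.ι ''ᵁ V)) : ∑ k, I V k (P V k s) = s := by
    have h : ∀ t : Finset (Fin n), (∑ k ∈ t, p k ≫ i k).app V s =
        ∑ k ∈ t, I V k (P V k s) := by
      intro t
      induction t using Finset.induction_on with
      | empty => rfl
      | insert k t hk ih => rw [Finset.sum_insert hk, Finset.sum_insert hk, ← ih]; rfl
    rw [← h, hsum]
    rfl
  have hU : U ≤ U.ι ''ᵁ ⊤ := by simp
  refine ⟨fun j ↦ res M hU (I ⊤ j 1), fun V hV ↦ ?_⟩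
  obtain ⟨V, rfl⟩ : ∃ V' : U.toScheme.Opens, V = U.ι ''ᵁ V' :=
    ⟨U.ι ⁻¹ᵁ V, by rw [Scheme.Hom.image_preimage_eq_opensRange_inf]; simpa using hV⟩
  have hres (j : Fin n) : res M hV (res M hU (I ⊤ j 1)) = I V j 1 := by
    rw [res_res]
    have h₁ := NatTrans.naturality_apply (i j).mapPresheaf (homOfLE (le_top : V ≤ ⊤)).op
      (show Γ(O, ⊤) from (1 : Γ(U.toScheme, ⊤)))
    exact h₁.symm.trans (congrArg ((i j).app V)
      (map_one (U.toScheme.presheaf.map (homOfLE (le_top : V ≤ ⊤)).op).hom))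
  have hlin (a : Fin n → Γ(X, U.ι ''ᵁ V)) : ∑ j, a j • I V j 1 = ∑ j, I V j (a j) :=
    Finset.sum_congr rfl fun j _ ↦ by rw [← map_smul, smul_eq_mul, mul_one]
  simp only [hres]
  refine Function.bijective_iff_has_inverse.mpr ⟨fun s k ↦ P V k s, fun a ↦ ?_, fun s ↦ ?_⟩
  · funext k
    simp [Fintype.linearCombination_apply, hlin, hIP]
  · rw [Fintype.linearCombination_apply, hlin, hsum']

lemma IsVectorBundle.exists_isFrame {M : X.Modules} (hM : IsVectorBundle M) (x : X) :
    ∃ U : X.Opens, x ∈ U ∧ ∃ (n : ℕ) (e : Fin n → Γ(M, U)), IsFrame e := by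
  obtain ⟨U, hxU, n, ⟨α⟩⟩ := hM x
  exact ⟨U, hxU, n, exists_isFrame_of_iso α⟩

end Existence

/-! ### Sections of monomorphisms and epimorphisms -/

section Sections

variable {X : Scheme.{0}}

instance (V : X.Opens) : Limits.PreservesFiniteLimits (sectionsFunctor V) :=
  @Limits.comp_preservesFiniteLimits _ _ _ _ _ _ _ _ inferInstance
    (PresheafOfModules.evaluation_preservesFiniteLimits X.ringCatSheaf.obj (op V))

lemma appLin_injective {M N : X.Modules} (φ : M ⟶ N) [Mono φ] (V : X.Opens) :
    Function.Injective (appLin φ V) :=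
  (ModuleCat.mono_iff_injective ((sectionsFunctor V).map φ)).mp inferInstance

lemma exact_appLin {S : ShortComplex X.Modules} (hS : S.Exact) [Mono S.f] (V : X.Opens) :
    Function.Exact (appLin S.f V) (appLin S.g V) :=
  (ShortComplex.ShortExact.moduleCat_exact_iff_function_exact _).mp
    (hS.map_of_mono_of_preservesKernel (sectionsFunctor V) inferInstance inferInstance)

/-- Every sheaf of modules is the sheafification of itself. -/
def associatedSheafIso :
    Scheme.Modules.toPresheafOfModules X ⋙ associatedSheaf X ≅ 𝟭 X.Modules :=
  let α := asIso (PresheafOfModules.sheafificationAdjunction.{0} (𝟙 X.ringCatSheaf.obj)).counit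
  α

instance : Limits.PreservesFiniteLimits (associatedSheaf X) :=
  inferInstanceAs (Limits.PreservesFiniteLimits
    (PresheafOfModules.sheafification.{0} (𝟙 X.ringCatSheaf.obj)))

/-- An epimorphism of sheaves of modules is an epimorphism of abelian sheaves. -/
instance : (abSheaf X).PreservesEpimorphisms where
  preserves {M N} φ hφ := by
    let F := Scheme.Modules.toPresheafOfModules X
    let ψ := F.map φ
    -- After sheafification the image factorisation of `ψ` becomes one of the epimorphism `φ`, so
    -- the image inclusion becomes an isomorphism.
    let e : Arrow.mk ((associatedSheaf X).map ψ) ≅ Arrow.mk φ :=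
      Arrow.isoMk (associatedSheafIso.app M) (associatedSheafIso.app N)
        (associatedSheafIso.hom.naturality φ).symm
    have hφ' : Epi ((associatedSheaf X).map ψ) :=
      ((MorphismProperty.epimorphisms _).arrow_mk_iso_iff e).mpr hφ
    let p := Abelian.factorThruImage ψ
    let j := Abelian.image.ι ψ
    have hpj : p ≫ j = ψ := Abelian.image.fac ψ
    have hj : Mono ((associatedSheaf X).map j) := inferInstance
    have hj' : Epi ((associatedSheaf X).map j) := by
      rw [← hpj, Functor.map_comp] at hφ'
      exact epi_of_epi ((associatedSheaf X).map p) _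
    have hiso : IsIso ((associatedSheaf X).map j) := isIso_of_mono_of_epi _
    have hp : Epi ((associatedSheaf X ⋙ abSheaf X).map p) :=
      haveI : Epi ((PresheafOfModules.toPresheaf X.ringCatSheaf.obj).map p) :=
        (PresheafOfModules.toPresheaf X.ringCatSheaf.obj).map_epi p
      (presheafToSheaf (Opens.grothendieckTopology X) AddCommGrpCat).map_epi
        ((PresheafOfModules.toPresheaf X.ringCatSheaf.obj).map p)
    have hψ : Epi ((abSheaf X).map ((associatedSheaf X).map ψ)) := by
      rw [← hpj, Functor.map_comp, Functor.map_comp]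
      exact epi_comp' hp inferInstance
    exact ((MorphismProperty.epimorphisms _).arrow_mk_iso_iff
      ((abSheaf X).mapArrow.mapIso e)).mp hψ

/-- An epimorphism of sheaves of modules is locally surjective on sections. -/
lemma exists_local_lift {M N : X.Modules} (φ : M ⟶ N) [Epi φ] {U : X.Opens} (s : Γ(N, U))
    {x : X} (hx : x ∈ U) :
    ∃ (V : X.Opens) (h : V ≤ U), x ∈ V ∧ ∃ t : Γ(M, V), appLin φ V t = res N h s := by
  have h : Epi ((abSheaf X).map φ) := inferInstance
  have := (TopCat.Sheaf.isLocallySurjective_iff_epi (X := X.toTopCat) ((abSheaf X).map φ)).mpr h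
  rw [TopCat.Presheaf.isLocallySurjective_iff] at this
  obtain ⟨V, i, ⟨t, ht⟩, hxV⟩ := this U s x hx
  exact ⟨V, i, hxV, t, ht⟩

end Sections

/-! ### Coordinates and pullback -/

section Fibre

variable {X T : Scheme.{0}} (g : T ⟶ X)

lemma app_resRing {U V : X.Opens} (h : V ≤ U) (a : Γ(X, U)) :
    (g.app V).hom (resRing h a) = resRing (g.preimage_mono h) ((g.app U).hom a) :=
  congr($(g.naturality (homOfLE h).op) a)

variable {M : X.Modules} {U : X.Opens} {n : ℕ} {e : Fin n → Γ(M, U)}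

/-- The structure sheaf as a sheaf of modules. -/
def structureModule (T : Scheme.{0}) : T.Modules := SheafOfModules.unit T.ringCatSheaf

/-- The coordinates over `U ⊓ V` of a section over `V`, as functions on the preimage of `V` under a
morphism `g : T ⟶ X` with image in `U`. -/
def coordVal (he : IsFrame e) (hU : g ⁻¹ᵁ U = ⊤) (i : Fin n) (V : X.Opens) :
    Γ(M, V) →+ Γ(T, g ⁻¹ᵁ V) :=
  have hle : g ⁻¹ᵁ V ≤ g ⁻¹ᵁ (U ⊓ V) := by
    rw [Scheme.Hom.preimage_inf, hU, top_inf_eq]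
  (resRing hle).toAddMonoidHom.comp ((g.app (U ⊓ V)).hom.toAddMonoidHom.comp
    ((Pi.evalAddMonoidHom _ i).comp ((he.coord inf_le_left).toLinearMap.toAddMonoidHom.comp
      (res M (inf_le_right : U ⊓ V ≤ V)))))

lemma coordVal_apply (he : IsFrame e) (hU : g ⁻¹ᵁ U = ⊤) (i : Fin n) (V : X.Opens) (s : Γ(M, V)) :
    coordVal g he hU i V s =
      resRing (by rw [Scheme.Hom.preimage_inf, hU, top_inf_eq])
        ((g.app (U ⊓ V)).hom (he.coord inf_le_left (res M inf_le_right s) i)) := rfl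

lemma coordVal_res (he : IsFrame e) (hU : g ⁻¹ᵁ U = ⊤) (i : Fin n) {V W : X.Opens} (h : W ≤ V)
    (s : Γ(M, V)) :
    coordVal g he hU i W (res M h s) = resRing (g.preimage_mono h) (coordVal g he hU i V s) := by
  have h' : U ⊓ W ≤ U ⊓ V := inf_le_inf_left _ h
  have : res M (inf_le_right : U ⊓ W ≤ W) (res M h s) =
      res M h' (res M (inf_le_right : U ⊓ V ≤ V) s) := by simp only [res_res]
  rw [coordVal_apply, coordVal_apply, this, he.coord_res inf_le_left h', app_resRing,
    resRing_resRing, resRing_resRing]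

lemma coordVal_smul (he : IsFrame e) (hU : g ⁻¹ᵁ U = ⊤) (i : Fin n) {V : X.Opens} (a : Γ(X, V))
    (s : Γ(M, V)) :
    coordVal g he hU i V (a • s) = (g.app V).hom a * coordVal g he hU i V s := by
  rw [coordVal_apply, coordVal_apply, res_smul, map_smul, Pi.smul_apply, smul_eq_mul, map_mul,
    map_mul, app_resRing, resRing_resRing]
  congr 1
  exact congr($(T.presheaf.map_id _) _)

lemma coordVal_frame (he : IsFrame e) (hU : g ⁻¹ᵁ U = ⊤) (i j : Fin n) :
    coordVal g he hU i U (e j) = if j = i then 1 else 0 := by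
  have : he.coord inf_le_left (res M (inf_le_right : U ⊓ U ≤ U) (e j)) = Pi.single j 1 := by
    rw [← he.coord_sum inf_le_left (Pi.single j 1)]
    simp
  rw [coordVal_apply, this, Pi.single_apply]
  rcases eq_or_ne i j with h | h
  · simp [h]
  · simp [h, h.symm]

/-- The `i`-th coordinate with respect to a frame over `U` as a morphism to the direct image of the
structure sheaf under a morphism `T ⟶ X` with image in `U`. -/
def coordHom (he : IsFrame e) (hU : g ⁻¹ᵁ U = ⊤) (i : Fin n) :
    M ⟶ (Scheme.Modules.pushforward g).obj (structureModule T) :=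
  ⟨PresheafOfModules.homMk
    { app := fun V ↦ AddCommGrpCat.ofHom (Y := Γ(T, g ⁻¹ᵁ V.unop)) (coordVal g he hU i V.unop)
      naturality := by
        intro V W k
        ext s
        exact coordVal_res g he hU i (leOfHom k.unop) s }
    (by
      intro V a s
      exact coordVal_smul g he hU i a s)⟩

/-- If the pullback of `f` along a morphism `g : T ⟶ X` with image in the common domain of two
frames is a monomorphism, then the rows of the pulled back matrix of `f` are linearly
independent. -/
lemma eq_zero_of_mono_pullback {N : X.Modules} {k : ℕ} {b : Fin k → Γ(N, U)} (he : IsFrame e)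
    (hb : IsFrame b) (hU : g ⁻¹ᵁ U = ⊤) (f : M ⟶ N) [Mono ((Scheme.Modules.pullback g).map f)]
    (c : Fin n → Γ(T, g ⁻¹ᵁ U))
    (hc : ∀ j, ∑ i, c i * (g.app U).hom (hb.coord le_rfl (appLin f U (e i)) j) = 0) :
    c = 0 := by
  -- A relation `c` between the rows makes `∑ cᵢ η(eᵢ)` vanish, where `η` is the unit of the
  -- adjunction between pullback and direct image. The adjuncts of the coordinate morphisms then recover `c`.
  let adj := Scheme.Modules.pullbackPushforwardAdjunction g
  let η (L : X.Modules) : Γ(L, U) →+ Γ((Scheme.Modules.pullback g).obj L, g ⁻¹ᵁ U) :=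
    ((adj.unit.app L).app U).hom
  have hη (L : X.Modules) (a : Γ(X, U)) (s : Γ(L, U)) : η L (a • s) = (g.app U).hom a • η L s :=
    Scheme.Modules.Hom.app_smul (adj.unit.app L) a s
  have hηf (s : Γ(M, U)) : appLin ((Scheme.Modules.pullback g).map f) (g ⁻¹ᵁ U) (η M s) =
      η N (appLin f U s) := by
    have := congr(($(adj.unit.naturality f)).app U s)
    exact this.symm
  have hsum : ∑ i, c i • η M (e i) = 0 := by
    apply appLin_injective ((Scheme.Modules.pullback g).map f)
    have hfe (i : Fin n) : η N (appLin f U (e i)) =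
        ∑ j, (g.app U).hom (hb.coord le_rfl (appLin f U (e i)) j) • η N (res N le_rfl (b j)) := by
      conv_lhs => rw [← hb.sum_coord le_rfl (appLin f U (e i)), map_sum]
      simp only [hη]
    simp only [map_sum, map_smul, hηf, map_zero, hfe, Finset.smul_sum, smul_smul]
    rw [Finset.sum_comm]
    simp only [← Finset.sum_smul, hc, zero_smul, Finset.sum_const_zero]
  funext l
  let ψ := (adj.homEquiv _ _).symm (coordHom g he hU l)
  have hψ (s : Γ(M, U)) : (show Γ(T, g ⁻¹ᵁ U) from appLin ψ (g ⁻¹ᵁ U) (η M s)) =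
      coordVal g he hU l U s := by
    have h₁ : adj.unit.app M ≫ (Scheme.Modules.pushforward g).map ψ = coordHom g he hU l :=
      (adj.homEquiv_unit _ _ _).symm.trans ((adj.homEquiv _ _).apply_symm_apply _)
    exact congr(($h₁).app U s)
  have h₂ := congrArg (appLin ψ (g ⁻¹ᵁ U)) hsum
  rw [map_sum, map_zero] at h₂
  have h₃ : ∑ i, c i * coordVal g he hU l U (e i) = 0 := by
    refine Eq.trans (Finset.sum_congr rfl fun i _ ↦ ?_) h₂
    exact (congrArg (c i * ·) (hψ (e i)).symm).trans
      ((appLin ψ (g ⁻¹ᵁ U)).map_smul (c i) (η M (e i))).symm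
  simpa [coordVal_frame] using h₃

end Fibre

/-! ### Matrices of functions near a point -/

section ResidueField

variable {X : Scheme.{0}}

/-- Pulling back a function to `Spec κ(x)` amounts to evaluating it at `x`. -/
lemma exists_evaluation_factorization {U : X.Opens} {x : X} (hx : x ∈ U) :
    ∃ θ : X.residueField x →+* Γ(Spec (X.residueField x), X.fromSpecResidueField x ⁻¹ᵁ U),
      Function.Injective θ ∧
      ∀ a, ((X.fromSpecResidueField x).app U).hom a = θ ((X.evaluation U x hx).hom a) := by
  let T := Spec (X.residueField x)
  let g : T ⟶ X := X.fromSpecResidueField x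
  let θ : X.residueField x ⟶ Γ(T, g ⁻¹ᵁ U) :=
    (Scheme.ΓSpecIso (X.residueField x)).inv ≫ T.presheaf.map (homOfLE le_top).op
  have hθ : g.app U = X.evaluation U x hx ≫ θ := by
    simp only [g, θ, Scheme.fromSpecResidueField, Scheme.Hom.comp_app, Scheme.evaluation]
    rw [Scheme.fromSpecStalk_app hx]
    simp only [Category.assoc]
    rw [Scheme.Hom.naturality, Scheme.ΓSpecIso_inv_naturality_assoc (X.residue x)]
    rfl
  have : Nonempty ↥(g ⁻¹ᵁ U) := by
    obtain ⟨y⟩ : Nonempty T := inferInstance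
    exact ⟨⟨y, by
      change g y ∈ U
      rwa [Scheme.fromSpecResidueField_apply]⟩⟩
  exact ⟨θ.hom, θ.hom.injective, fun a ↦ congr($hθ a)⟩

lemma evaluation_resRing {U V : X.Opens} (h : V ≤ U) {x : X} (hx : x ∈ V) (a : Γ(X, U)) :
    (X.evaluation V x hx).hom (resRing h a) = (X.evaluation U x (h hx)).hom a := by
  have := X.presheaf.germ_res (homOfLE h) x hx
  exact congr(($this ≫ X.residue x) a)

lemma exists_common_neighbourhood {ι : Type*} [Finite ι] {x : X} (V : ι → X.Opens)
    (hV : ∀ i, x ∈ V i) : ∃ W : X.Opens, x ∈ W ∧ ∀ i, W ≤ V i :=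
  ⟨⟨⋂ i, V i, isOpen_iInter_of_finite fun i ↦ (V i).2⟩, Set.mem_iInter.mpr hV,
    fun i _ hy ↦ Set.mem_iInter.mp hy i⟩

lemma exists_evaluation_eq (x : X) (c : X.residueField x) :
    ∃ (U : X.Opens) (hx : x ∈ U) (a : Γ(X, U)), (X.evaluation U x hx).hom a = c := by
  obtain ⟨s, rfl⟩ := X.residue_surjective x c
  obtain ⟨U, hx, a, rfl⟩ := X.presheaf.exists_germ_eq s
  exact ⟨U, hx, a, rfl⟩

/-- A matrix with linearly independent rows over a field has a right inverse. -/
lemma exists_mul_eq_one {k : Type*} [Field k] {n m : ℕ} (A : Matrix (Fin n) (Fin m) k)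
    (hA : ∀ c, Matrix.vecMul c A = 0 → c = 0) : ∃ B : Matrix (Fin m) (Fin n) k, A * B = 1 := by
  obtain ⟨L, hL⟩ := LinearMap.exists_leftInverse_of_injective A.vecMulLinear
    (LinearMap.ker_eq_bot'.mpr hA)
  refine ⟨(LinearMap.toMatrix' L).transpose, ?_⟩
  rw [← Matrix.transpose_inj, Matrix.transpose_mul, Matrix.transpose_transpose,
    Matrix.transpose_one]
  have : A.vecMulLinear = Matrix.toLin' A.transpose := by
    ext; simp [Matrix.vecMul, Matrix.mulVec, dotProduct_comm]
  rw [this] at hL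
  have := congrArg LinearMap.toMatrix' hL
  rwa [LinearMap.toMatrix'_comp, LinearMap.toMatrix'_toLin', LinearMap.toMatrix'_id] at this

/-- A matrix of functions whose value at `x` has linearly independent rows has a right inverse
near `x`. -/
lemma exists_right_inverse_near {U : X.Opens} {x : X} (hx : x ∈ U) {n m : ℕ}
    (A : Matrix (Fin n) (Fin m) Γ(X, U))
    (hA : ∀ c, Matrix.vecMul c (A.map (X.evaluation U x hx).hom) = 0 → c = 0) :
    ∃ (V : X.Opens) (h : V ≤ U), x ∈ V ∧ ∃ B : Matrix (Fin m) (Fin n) Γ(X, V),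
      A.map (resRing h) * B = 1 := by
  obtain ⟨B, hB⟩ := exists_mul_eq_one _ hA
  choose Z hxZ b hb using fun p : Fin m × Fin n ↦ exists_evaluation_eq x (B p.1 p.2)
  obtain ⟨W', hxW', hW'⟩ := exists_common_neighbourhood Z hxZ
  let W := U ⊓ W'
  have hxW : x ∈ W := ⟨hx, hxW'⟩
  have hWU : W ≤ U := inf_le_left
  let ev := (X.evaluation W x hxW).hom
  -- `C` lifts the right inverse at `x` to functions near `x`.
  let C : Matrix (Fin m) (Fin n) Γ(X, W) :=
    .of fun j l ↦ resRing (inf_le_right.trans (hW' (j, l))) (b (j, l))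
  let Q := A.map (resRing hWU) * C
  have hQ : ev.mapMatrix Q = 1 := by
    rw [← hB, RingHom.mapMatrix_apply, Matrix.map_mul]
    congr 1
    · ext i j
      exact evaluation_resRing _ _ _
    · ext j l
      exact (evaluation_resRing _ _ _).trans (hb (j, l))
  -- The determinant of `Q` does not vanish at `x`, so `Q` is invertible on its basic open set.
  have hdet : ev Q.det ≠ 0 := by
    rw [RingHom.map_det, hQ, Matrix.det_one]
    exact one_ne_zero
  have hVW : X.basicOpen Q.det ≤ W := X.basicOpen_le _
  refine ⟨X.basicOpen Q.det, hVW.trans hWU,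
    (Scheme.evaluation_ne_zero_iff_mem_basicOpen X x hxW _).mp hdet,
    C.map (resRing hVW) * (Q.map (resRing hVW))⁻¹, ?_⟩
  have hA' : A.map (resRing (hVW.trans hWU)) = (A.map (resRing hWU)).map (resRing hVW) := by
    ext i j
    exact (resRing_resRing _ _ _).symm
  rw [hA', ← Matrix.mul_assoc, ← Matrix.map_mul]
  refine Matrix.mul_nonsing_inv _ ?_
  have : (Q.map (resRing hVW)).det = resRing hVW Q.det := ((resRing hVW).map_det Q).symm
  rw [this]
  exact RingedSpace.isUnit_res_basicOpen X.toRingedSpace Q.det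

end ResidueField

/-! ### Local retractions -/

section Retraction

variable {X : Scheme.{0}}

/-- A retraction of `f : M ⟶ N` over an open set `U`: linear retractions on the sections over all
open subsets of `U`, compatible with restriction. -/
structure RetractionOn {M N : X.Modules} (f : M ⟶ N) (U : X.Opens) where
  /-- The retraction on sections over `V`. -/
  map (V : X.Opens) (h : V ≤ U) : Γ(N, V) →ₗ[Γ(X, V)] Γ(M, V)
  map_app (V : X.Opens) (h : V ≤ U) (s : Γ(M, V)) : map V h (appLin f V s) = s
  map_res {V W : X.Opens} (h : V ≤ U) (h' : W ≤ V) (s : Γ(N, V)) :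
    map W (h'.trans h) (res N h' s) = res M h' (map V h s)

/-- A retraction of a composition restricts to a retraction of the first map. -/
def RetractionOn.ofComp {L M N : X.Modules} {u : L ⟶ M} {j : M ⟶ N} {f : L ⟶ N} (hf : f = u ≫ j)
    {U : X.Opens} (r : RetractionOn f U) : RetractionOn u U where
  map V h := r.map V h ∘ₗ appLin j V
  map_app V h s := by
    subst hf
    exact r.map_app V h s
  map_res h h' s := by
    rw [LinearMap.comp_apply, appLin_res, r.map_res]
    rfl

/-- A morphism of vector bundles which is injective on the fibre at `x` has a retraction near
`x`. -/
lemma exists_retractionOn {M N : X.Modules} (hM : IsVectorBundle M) (hN : IsVectorBundle N)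
    (f : M ⟶ N) (x : X) [Mono ((Scheme.Modules.pullback (X.fromSpecResidueField x)).map f)] :
    ∃ U : X.Opens, x ∈ U ∧ Nonempty (RetractionOn f U) := by
  obtain ⟨U₁, hx₁, n, e₁, he₁⟩ := hM.exists_isFrame x
  obtain ⟨U₂, hx₂, m, b₁, hb₁⟩ := hN.exists_isFrame x
  let U := U₁ ⊓ U₂
  have hx : x ∈ U := ⟨hx₁, hx₂⟩
  have he := he₁.restrict (inf_le_left : U ≤ U₁)
  have hb := hb₁.restrict (inf_le_right : U ≤ U₂)
  set e : Fin n → Γ(M, U) := fun i ↦ res M inf_le_left (e₁ i)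
  set b : Fin m → Γ(N, U) := fun i ↦ res N inf_le_right (b₁ i)
  let A : Matrix (Fin n) (Fin m) Γ(X, U) := .of fun i j ↦ hb.coord le_rfl (appLin f U (e i)) j
  have hfe (i : Fin n) : appLin f U (e i) = ∑ j, A i j • b j := by
    conv_lhs => rw [← hb.sum_coord le_rfl (appLin f U (e i))]
    refine Finset.sum_congr rfl fun j _ ↦ congrArg (A i j • ·) ?_
    exact congr($(N.presheaf.map_id _) (b j))
  obtain ⟨V, hVU, hxV, B, hAB⟩ := exists_right_inverse_near hx A fun c hc ↦ by
    obtain ⟨θ, hθ, hθ'⟩ := exists_evaluation_factorization hx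
    have hU : X.fromSpecResidueField x ⁻¹ᵁ U = ⊤ := by
      ext y
      simpa using hx
    have := eq_zero_of_mono_pullback _ he hb hU f (fun i ↦ θ (c i)) fun j ↦ by
      refine (Finset.sum_congr rfl fun i _ ↦ congrArg (θ (c i) * ·) (hθ' _)).trans ?_
      simp only [← map_mul, ← map_sum]
      exact (congrArg θ (congrFun hc j)).trans (map_zero θ)
    funext i
    exact hθ ((congrFun this i).trans (map_zero θ).symm)
  refine ⟨V, hxV, ⟨?_⟩⟩
  let r (j : Fin m) : Γ(M, V) := ∑ l, B j l • res M hVU (e l)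
  let R (W : X.Opens) (h : W ≤ V) : Γ(N, W) →ₗ[Γ(X, W)] Γ(M, W) :=
    Fintype.linearCombination Γ(X, W) (fun j ↦ res M h (r j)) ∘ₗ
      (hb.coord (h.trans hVU)).toLinearMap
  have hR (W : X.Opens) (h : W ≤ V) (s) :
      R W h s = ∑ j, hb.coord (h.trans hVU) s j • res M h (r j) := rfl
  have hRe (i : Fin n) : R V le_rfl (appLin f V (res M hVU (e i))) = res M hVU (e i) := by
    have h₁ : hb.coord (le_rfl.trans hVU) (appLin f V (res M hVU (e i))) =
        fun j ↦ A.map (resRing hVU) i j := by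
      funext j
      rw [appLin_res, hb.coord_res le_rfl hVU]
      rfl
    have h₂ (j) : res M (le_refl V) (r j) = r j := congr($(M.presheaf.map_id _) (r j))
    rw [hR, h₁]
    simp only [h₂, r, Finset.smul_sum, smul_smul]
    rw [Finset.sum_comm]
    simp only [← Finset.sum_smul, ← Matrix.mul_apply, hAB, Matrix.one_apply, ite_smul, one_smul,
      zero_smul, Finset.sum_ite_eq, Finset.mem_univ, if_true]
  have hRres {W W' : X.Opens} (h : W ≤ V) (h' : W' ≤ W) (s : Γ(N, W)) :
      R W' (h'.trans h) (res N h' s) = res M h' (R W h s) := by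
    rw [hR, hR, map_sum]
    refine Finset.sum_congr rfl fun j _ ↦ ?_
    rw [hb.coord_res (h.trans hVU) h', res_smul, res_res]
  refine ⟨R, fun W h s ↦ ?_, hRres⟩
  have hRe' (i : Fin n) : R W h (appLin f W (res M (h.trans hVU) (e i))) =
      res M (h.trans hVU) (e i) := by
    rw [← res_res M hVU h, appLin_res, hRres le_rfl h, hRe]
  rw [← he.sum_coord (h.trans hVU) s]
  simp only [map_sum, map_smul, hRe']

/-- If `u` has a retraction over `U`, then its cokernel `v` is surjective on sections over the open
subsets of `U`: the retraction singles out, among the local lifts of a section, those it kills,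
and these agree on overlaps. -/
lemma RetractionOn.surjective {S : ShortComplex X.Modules} (hS : S.ShortExact) {U : X.Opens}
    (r : RetractionOn S.f U) {V : X.Opens} (hV : V ≤ U) : Function.Surjective (appLin S.g V) := by
  intro s
  have := hS.mono_f
  have := hS.epi_g
  choose W hWV hxW t ht using fun y : V ↦ exists_local_lift S.g s y.2
  have hgf (Z : X.Opens) (a : Γ(S.X₁, Z)) : appLin S.g Z (appLin S.f Z a) = 0 :=
    congr(($(S.zero)).app Z a)
  -- Corrected lifts, killed by the retraction.
  let k (y : V) : Γ(S.X₂, W y) :=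
    t y - appLin S.f (W y) (r.map (W y) ((hWV y).trans hV) (t y))
  have hk (y : V) : appLin S.g (W y) (k y) = res S.X₃ (hWV y) s := by
    rw [map_sub, hgf, sub_zero, ht]
  have hrk (y : V) : r.map (W y) ((hWV y).trans hV) (k y) = 0 := by
    rw [map_sub, r.map_app, sub_self]
  have hcompat (y z : V) : res S.X₂ (inf_le_left : W y ⊓ W z ≤ W y) (k y) =
      res S.X₂ (inf_le_right : W y ⊓ W z ≤ W z) (k z) := by
    rw [← sub_eq_zero]
    obtain ⟨a, ha⟩ := (exact_appLin hS.exact (W y ⊓ W z)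
      (res S.X₂ inf_le_left (k y) - res S.X₂ inf_le_right (k z))).mp (by
        rw [map_sub, appLin_res, appLin_res, hk, hk, res_res, res_res, sub_self])
    have hle : W y ⊓ W z ≤ U := inf_le_left.trans ((hWV y).trans hV)
    have h₀ := r.map_app _ hle a
    rw [ha, map_sub, r.map_res ((hWV y).trans hV) inf_le_left,
      r.map_res ((hWV z).trans hV) inf_le_right, hrk, hrk, map_zero, map_zero, sub_zero] at h₀
    rw [← ha, ← h₀, map_zero]
  have hcover : V ≤ ⨆ y, W y := fun y hy ↦ Opens.mem_iSup.mpr ⟨⟨y, hy⟩, hxW ⟨y, hy⟩⟩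
  obtain ⟨q, hq, -⟩ := TopCat.Sheaf.existsUnique_gluing' (X := X.toTopCat)
    ⟨S.X₂.presheaf, S.X₂.isSheaf⟩ W V (fun y ↦ homOfLE (hWV y)) hcover k hcompat
  refine ⟨q, ?_⟩
  refine TopCat.Sheaf.eq_of_locally_eq' (X := X.toTopCat) ⟨S.X₃.presheaf, S.X₃.isSheaf⟩
    W V (fun y ↦ homOfLE (hWV y)) hcover _ _ fun y ↦ ?_
  change res S.X₃ (hWV y) _ = res S.X₃ (hWV y) s
  rw [← appLin_res, ← hk]
  exact congrArg _ (hq y)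

end Retraction

/-! ### Local splittings of short exact sequences -/

section LocalSplittings

variable {X : Scheme.{0}}

/-- A short exact sequence ending in a vector bundle is locally split: a frame of the bundle lifts
locally, so sections over small open sets form a short exact sequence ending in a free module. -/
lemma isLocallySplit_of_isVectorBundle {S : ShortComplex X.Modules} (hS : S.ShortExact)
    (h₃ : IsVectorBundle S.X₃) : IsLocallySplit S := by
  intro x
  have := hS.mono_f
  have := hS.epi_g
  obtain ⟨U, hxU, n, e, he⟩ := h₃.exists_isFrame x
  choose W hWU hxW t ht using fun i ↦ exists_local_lift S.g (e i) hxU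
  obtain ⟨Z, hxZ, hZ⟩ := exists_common_neighbourhood W hxW
  refine ⟨U ⊓ Z, ⟨hxU, hxZ⟩, fun V hV ↦ ?_⟩
  have hVU : V ≤ U := hV.trans inf_le_left
  have hVW (i) : V ≤ W i := (hV.trans inf_le_right).trans (hZ i)
  have hsurj : Function.Surjective (appLin S.g V) := fun s ↦ by
    refine ⟨∑ i, he.coord hVU s i • res S.X₂ (hVW i) (t i), ?_⟩
    simp only [map_sum, map_smul, appLin_res, ht, res_res]
    exact he.sum_coord hVU s
  have hfree : Module.Free Γ(X, V) Γ(S.X₃, V) := Module.Free.of_equiv (he.coord hVU).symm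
  have hproj : Projective (S.map (sectionsFunctor V)).X₃ :=
    (IsProjective.iff_projective _).mp (inferInstanceAs (Module.Projective Γ(X, V) Γ(S.X₃, V)))
  have hse : (S.map (sectionsFunctor V)).ShortExact :=
    { exact := hS.exact.map_of_mono_of_preservesKernel _ inferInstance inferInstance
      mono_f := (sectionsFunctor V).map_mono S.f
      epi_g := (ModuleCat.epi_iff_surjective ((sectionsFunctor V).map S.g)).mpr hsurj }
  exact ⟨hse.splittingOfProjective⟩

lemma isLocallySplit_of_retractionOn {S : ShortComplex X.Modules} (hS : S.ShortExact)
    (h : ∀ x : X, ∃ U : X.Opens, x ∈ U ∧ Nonempty (RetractionOn S.f U)) : IsLocallySplit S := by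
  intro x
  have := hS.mono_f
  obtain ⟨U, hxU, ⟨r⟩⟩ := h x
  refine ⟨U, hxU, fun V hV ↦ ⟨?_⟩⟩
  have hepi : Epi (S.map (sectionsFunctor V)).g :=
    (ModuleCat.epi_iff_surjective ((sectionsFunctor V).map S.g)).mpr (r.surjective hS hV)
  exact ShortComplex.Splitting.ofExactOfRetraction _
    (hS.exact.map_of_mono_of_preservesKernel _ inferInstance inferInstance)
    (ModuleCat.ofHom (R := Γ(X, V)) (X := Γ(S.X₂, V)) (Y := Γ(S.X₁, V)) (r.map V hV))
    (ModuleCat.hom_ext (LinearMap.ext (r.map_app V hV))) hepi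

end LocalSplittings

/-! ### The display of a monad -/

section Display

variable {X : Scheme.{0}} (S : ShortComplex X.Modules)

/-- The sequence `0 ⟶ ker g ⟶ B ⟶ C ⟶ 0` of a complex `A ⟶ B ⟶ C`. -/
def cyclesSequence : ShortComplex X.Modules := ShortComplex.mk S.iCycles S.g S.iCycles_g

/-- The sequence `0 ⟶ A ⟶ ker g ⟶ E ⟶ 0` of a complex `A ⟶ B ⟶ C` with cohomology `E`. -/
def homologySequence : ShortComplex X.Modules :=
  ShortComplex.mk S.toCycles S.homologyπ S.toCycles_comp_homologyπ

variable {S}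

lemma IsMonad.shortExact_cyclesSequence (hS : IsMonad S) : (cyclesSequence S).ShortExact where
  exact := ShortComplex.exact_of_f_is_kernel _ S.cyclesIsKernel
  mono_f := inferInstanceAs (Mono S.iCycles)
  epi_g := hS.epi

lemma IsMonad.shortExact_homologySequence (hS : IsMonad S) : (homologySequence S).ShortExact where
  exact := ShortComplex.exact_of_g_is_cokernel _ S.homologyIsCokernel
  mono_f := by
    have : Mono (S.toCycles ≫ S.iCycles) := by
      rw [S.toCycles_i]
      exact hS.mono
    exact mono_of_mono S.toCycles S.iCycles
  epi_g := inferInstanceAs (Epi S.homologyπ)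

lemma IsMonad.isLocallySplit_cyclesSequence (hS : IsMonad S) : IsLocallySplit (cyclesSequence S) :=
  isLocallySplit_of_isVectorBundle hS.shortExact_cyclesSequence hS.vectorBundle₃

lemma IsMonad.isLocallySplit_homologySequence (hS : IsMonad S) :
    IsLocallySplit (homologySequence S) :=
  isLocallySplit_of_retractionOn hS.shortExact_homologySequence fun x ↦ by
    have := hS.fibre_mono x
    obtain ⟨U, hxU, ⟨r⟩⟩ := exists_retractionOn hS.vectorBundle₁ hS.vectorBundle₂ S.f x
    exact ⟨U, hxU, ⟨r.ofComp S.toCycles_i.symm⟩⟩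

end Display

/-! ### Natural cohomology -/

section NaturalCohomology

lemma subsingleton_of_natural {S : ShortComplex P1xP1.Modules} (hnat : HasNaturalCohomology S)
    {n m : ℤ} {i : ℕ} (hi : Nontrivial (HMonad i S n m)) (j : ℕ) (hj : j ≠ i) :
    Subsingleton (H j ((twist n m).obj S.X₁)) ∧ Subsingleton (H j ((twist n m).obj S.X₂)) ∧
      Subsingleton (H j ((twist n m).obj S.X₃)) := by
  have h : Subsingleton (HMonad j S n m) :=
    not_nontrivial_iff_subsingleton.mp fun h ↦ hj (hnat n m j i h hi)
  exact ⟨⟨fun a b ↦ congrArg (·.1) (h.elim (a, 0, 0) (b, 0, 0))⟩,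
    ⟨fun a b ↦ congrArg (·.2.1) (h.elim (0, a, 0) (0, b, 0))⟩,
    ⟨fun a b ↦ congrArg (·.2.2) (h.elim (0, 0, a) (0, 0, b))⟩⟩

end NaturalCohomology

end MonadCohomology
end

theorem propositionp (S : ShortComplex P1xP1.Modules) (hS : IsMonad S)
    (hnat : HasNaturalCohomology S) (n m : ℤ) :
    (Nontrivial (HMonad 0 S n m) →
      Nonempty (H 0 ((twist n m).obj (cohomologyBundle S)) ≃ₗ[ℂ]
        (LinearMap.ker (mapH 0 ((twist n m).map S.g)) ⧸
          (LinearMap.range (mapH 0 ((twist n m).map S.f))).submoduleOf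
            (LinearMap.ker (mapH 0 ((twist n m).map S.g))))) ∧
      Nonempty (H 1 ((twist n m).obj (cohomologyBundle S)) ≃ₗ[ℂ]
        (H 0 ((twist n m).obj S.X₃) ⧸ LinearMap.range (mapH 0 ((twist n m).map S.g)))) ∧
      Subsingleton (H 2 ((twist n m).obj (cohomologyBundle S)))) ∧
    (Nontrivial (HMonad 1 S n m) →
      Nonempty (H 0 ((twist n m).obj (cohomologyBundle S)) ≃ₗ[ℂ]
        LinearMap.ker (mapH 1 ((twist n m).map S.f))) ∧
      Nonempty (H 1 ((twist n m).obj (cohomologyBundle S)) ≃ₗ[ℂ]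
        (LinearMap.ker (mapH 1 ((twist n m).map S.g)) ⧸
          (LinearMap.range (mapH 1 ((twist n m).map S.f))).submoduleOf
            (LinearMap.ker (mapH 1 ((twist n m).map S.g))))) ∧
      Nonempty (H 2 ((twist n m).obj (cohomologyBundle S)) ≃ₗ[ℂ]
        (H 1 ((twist n m).obj S.X₃) ⧸ LinearMap.range (mapH 1 ((twist n m).map S.g))))) ∧
    (Nontrivial (HMonad 2 S n m) →
      Subsingleton (H 0 ((twist n m).obj (cohomologyBundle S))) ∧
      Nonempty (H 1 ((twist n m).obj (cohomologyBundle S)) ≃ₗ[ℂ]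
        LinearMap.ker (mapH 2 ((twist n m).map S.f))) ∧
      Nonempty (H 2 ((twist n m).obj (cohomologyBundle S)) ≃ₗ[ℂ]
        (LinearMap.ker (mapH 2 ((twist n m).map S.g)) ⧸
          (LinearMap.range (mapH 2 ((twist n m).map S.f))).submoduleOf
            (LinearMap.ker (mapH 2 ((twist n m).map S.g)))))) := by

  have h₁ := hS.isLocallySplit_cyclesSequence.shortExact_tensor (P1xP1.lineBundle n m)
  have h₂ := hS.isLocallySplit_homologySequence.shortExact_tensor (P1xP1.lineBundle n m)
  have hf : (twist n m).map S.f = (twist n m).map S.toCycles ≫ (twist n m).map S.iCycles := by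
    rw [← Functor.map_comp, S.toCycles_i]
  exact ⟨fun h ↦ cohomology_of_display_zero h₁ h₂ hf (subsingleton_of_natural hnat h),
    fun h ↦ cohomology_of_display_one h₁ h₂ hf (subsingleton_of_natural hnat h),
    fun h ↦ cohomology_of_display_two h₁ h₂ hf (subsingleton_of_natural hnat h)⟩
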